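/- **Theorem 4.1.** Let $(\mathcal O,\mathfrak m)$ be a two-dimensional regular local ring containing a perfect field $k$ that maps isomorphically onto the residue field $\mathcal O/\mathfrak m$. Let $0\ne f\in\mathfrak m^2$ be such that $f$ is not of the form $u\,y^n$ with $u$ a unit, $y$ a regular parameter and $n\ge 0$. Let $\nu\ge 2$ be the order of $f$, i.e. $f\in\mathfrak m^\nu\setminus\mathfrak m^{\nu+1}$. *Polyhedra.* For a regular system of parameters $(x,y)$, write $f=\sum c_{a,b}x^ay^b$ with $c_{a,b}\in k$ in $\widehat{\mathcal O}=k[[x,y]]$. Let $\Delta(f;x;y)\subset\mathbb R$ be the smallest closed convex set containing $\frac{a}{\nu-b}+\mathbb R_{\ge0}$ for all $(a,b)$ with $c_{a,b}\neq0$ and $b<\nu$, and put $\Delta(f;x)=\bigcap_{y'}\Delta(f;x;y')$, the intersection over all $y'\in\mathcal O$ such that $(x,y')$ is a regular system of parameters. *Adapted parameters.* A regular system of parameters $(x,z)$ is called adapted to $f$ if $\Delta(f;x;z)=\Delta(f;x)$ and moreover, in case $f\equiv u\,y^\nu \bmod \mathfrak m^{\nu+1}$ for some unit $u$ and some regular parameter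 $y$, one has $f\equiv u'z^\nu\bmod\mathfrak m^{\nu+1}$ for some unit $u'$. *Centers.* For a regular system of parameters $(x_1,x_2)$ and rational numbers $0<a_1\le a_2$, the center $J=(x_1^{a_1},x_2^{a_2})$ is the monomial valuation $$v_J\Big(\sum d_{i_1,i_2}x_1^{i_1}x_2^{i_2}\Big)=\min\Big\{\tfrac{i_1}{a_1}+\tfrac{i_2}{a_2}\ \Big|\ d_{i_1,i_2}\ne0\Big\},\qquad v_J(0)=\infty ,$$ and two centers are equal if their valuations on $\mathcal O$ are equal. $J$ is admissible for $f$ if $v_J(f)\ge1$. Let $(x,z)$ be adapted to $f$. Then $\Delta(f;x)=[\delta,\infty)$ for a rational number $\delta$; set $(a_1,a_2)=(\nu,\nu\delta)$ and $(x_1,x_2)=(z,x)$. One has $a_1\le a_2$, and: 1. $J=(x_1^{a_1},x_2^{a_2})$ is admissible for $f$. 2. If $(y_1^{b_1},y_2^{b_2})$, with $b_1\le b_2$, is any center admissible for $f$, then $(b_1,b_2)\le(a_1,a_2)$ lexicographically; if equality holds, then $(y_1^{b_1},y_2^{b_2})=J$. 3. $J$ does not depend on the choice of parameters: if $(x',z')$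 is also adapted to $f$, then $\Delta(f;x')=[\delta,\infty)$ and $(z'^{\,a_1},x'^{\,a_2})=J$. -/

import Mathlib

open IsLocalRing

namespace PlaneCurve

variable (k : Type*) {O : Type*} [Field k] [CommRing O] [IsLocalRing O] [Algebra k O]

/-- `(x, y)` generates the maximal ideal. In a two-dimensional regular local ring this says that
`(x, y)` is a regular system of parameters. -/
def IsRSP (x y : O) : Prop := Ideal.span {x, y} = maximalIdeal O

/-- A (regular) parameter: a member of some regular system of parameters. -/
def IsParameter (y : O) : Prop := ∃ x : O, IsRSP x y

/-- `g = ∑ c (a, b) x ^ a y ^ b` in the completion of `O` for the maximal ideal: `g` is congruent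
to the partial sum of degree `< n` modulo the `n`-th power of the maximal ideal, for all `n`.
If `k` is a coefficient field of the two-dimensional regular local ring `O` and `(x, y)` is a
regular system of parameters, then every `g` has exactly one such expansion, since the completion
is `k⟦x, y⟧`. -/
def IsExpansion (x y g : O) (c : ℕ × ℕ → k) : Prop :=
  ∀ n : ℕ, g - ∑ d ∈ Finset.range n, ∑ p ∈ Finset.HasAntidiagonal.antidiagonal d,
    algebraMap k O (c p) * (x ^ p.1 * y ^ p.2) ∈ maximalIdeal O ^ n

/-- The exponents `(a, b)` such that `x ^ a y ^ b` has a nonzero coefficient in the expansion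
of `g` with respect to `(x, y)`. -/
def expSupport (x y g : O) : Set (ℕ × ℕ) := {p | ∃ c, IsExpansion k x y g c ∧ c p ≠ 0}

/-- The order of `f` at the maximal ideal (for `f ≠ 0` in a Noetherian local ring). -/
noncomputable def order (f : O) : ℕ := sSup {n : ℕ | f ∈ maximalIdeal O ^ n}

/-- The projected polyhedron `Δ(f; x; y)`: the smallest closed convex set that contains the rays
`a / (ν - b) + ℝ_{≥ 0}` for the monomials `x ^ a y ^ b` of `f` with `b < ν`, where `ν` is the order
of `f`. Monomials with `b ≥ ν` have no projection from the point `(0, ν)` to the first axis. -/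
noncomputable def projectedPolyhedron (f x y : O) : Set ℝ :=
  closedConvexHull ℝ (⋃ p ∈ {p ∈ expSupport k x y f | p.2 < order f},
    Set.Ici ((p.1 : ℝ) / ((order f : ℝ) - (p.2 : ℝ))))

/-- The characteristic polyhedron `Δ(f; x)`: the intersection of the `Δ(f; x; y)` over all `y` that
complete `x` to a regular system of parameters. -/
noncomputable def characteristicPolyhedron (f x : O) : Set ℝ :=
  ⋂ y ∈ {y : O | IsRSP x y}, projectedPolyhedron k f x y

/-- The admitted choices of parameters `(x, z)` for `f`. If the initial form of `f` is, up to a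
nonzero constant, the `ν`-th power of a linear form, then `z` has to span the same tangent direction;
and `z` satisfies `Δ(f; x; z) = Δ(f; x)`. -/
structure IsAdapted (f x z : O) : Prop where
  isRSP : IsRSP x z
  tangent : (∃ y u : O, IsParameter y ∧ IsUnit u ∧
      f - u * y ^ order f ∈ maximalIdeal O ^ (order f + 1)) →
    ∃ u : O, IsUnit u ∧ f - u * z ^ order f ∈ maximalIdeal O ^ (order f + 1)
  polyhedron : projectedPolyhedron k f x z = characteristicPolyhedron k f x

/-- The data `(x₁ ^ a₁, x₂ ^ a₂)` presenting a center: parameters and positive rational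
exponents with `a₁ ≤ a₂`. Two presentations give the same center if they have the same
monomial valuation `Center.val`. -/
structure Center (O : Type*) [CommRing O] [IsLocalRing O] where
  x₁ : O
  x₂ : O
  a₁ : ℚ
  a₂ : ℚ
  isRSP : IsRSP x₁ x₂
  a₁_pos : 0 < a₁
  a₁_le_a₂ : a₁ ≤ a₂

/-- The monomial valuation `v_J`, with `v_J(x₁) = 1 / a₁` and `v_J(x₂) = 1 / a₂`:
the minimum of `i₁ / a₁ + i₂ / a₂` over the monomials `x₁ ^ i₁ x₂ ^ i₂` of `g`; it is `⊤` at `0`. -/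
noncomputable def Center.val (J : Center O) (g : O) : EReal :=
  ⨅ i ∈ expSupport k J.x₁ J.x₂ g,
    (((i.1 : ℝ) / (J.a₁ : ℝ) + (i.2 : ℝ) / (J.a₂ : ℝ) : ℝ) : EReal)

/-- `J` is admissible for `f` if `v_J(f) ≥ 1`. -/
def Center.Admissible (J : Center O) (f : O) : Prop := 1 ≤ J.val k f

end PlaneCurve

/-! Both `Δ(f; x; y) ⊆ [d, ∞)` with `d > 0` and `v_J(f) ≥ t` say that `f` lies in a monomial ideal
`weightIdeal` (`IsRSP.mem_weightIdeal_iff`), so the argument compares weight filtrations inside `O`,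
without passing to the completion.

Let `ν` be the order of `f` and `(y ^ b₁, w ^ b₂)` an admissible center. If `b₁ > ν`, all monomials
of weight at least one have degree above `ν`, contradicting the order. If `b₁ = ν < b₂`, then `y ^
ν` is the only such monomial of degree at most `ν`, so `f ≡ r y ^ ν` modulo `𝔪 ^ (ν + 1)` with `r` a
unit. Adaptedness gives `z` the same tangent, so `(x, y)` is again a system of parameters and `w`
can be replaced by `x` (`IsAdapted.isRSP_and_weightIdeal_eq`). Hence `Δ(f; x; y) ⊆ [b₂ / ν, ∞)`,
which gives `b₂ ≤ ν δ`.

In case of equality `y` and `z` have weight `1 / ν` with respect to each other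
(`IsRSP.mem_weightIdeal_of_mem`), so the valuations agree; for `δ = 1` both filtrations are `𝔪`-adic
up to scaling. Finally, two adapted systems give admissible centers that bound each other, so
uniqueness identifies them. -/

namespace PlaneCurve

/-! ### Independence of monomials in regular parameters -/

section RegularSequence

/-- In a Noetherian local ring of dimension at least two whose maximal ideal is `(x, y)`, no power
of `y` is a multiple of `x`. -/
lemma IsRSP.not_dvd_pow {D : Type*} [CommRing D] [IsLocalRing D] [IsNoetherianRing D]
    (hdim : 2 ≤ ringKrullDim D) {x y : D} (h : IsRSP x y) (n : ℕ) : ¬ x ∣ y ^ n := by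
  intro hxy
  have hle : maximalIdeal D ≤ (Ideal.span {x}).radical := by
    rw [← h, Ideal.span_le]
    rintro w (rfl | rfl)
    · exact Ideal.le_radical (Ideal.mem_span_singleton_self w)
    · exact ⟨n, Ideal.mem_span_singleton.2 hxy⟩
  have hxm : x ∈ maximalIdeal D := h ▸ Ideal.subset_span (by simp)
  have hmin : maximalIdeal D ∈ (Ideal.span {x}).minimalPrimes := by
    refine ⟨⟨inferInstance, (Ideal.span_singleton_le_iff_mem _).2 hxm⟩, fun q hq _ => ?_⟩
    exact hle.trans (hq.1.radical_le_iff.2 hq.2)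
  have h1 := Ideal.height_le_one_of_isPrincipal_of_mem_minimalPrimes _ _ hmin
  have h2 := IsLocalRing.maximalIdeal_height_eq_ringKrullDim (R := D)
  rw [← h2] at hdim
  have : (2 : ℕ∞) ≤ (maximalIdeal D).height := WithBot.coe_le_coe.1 hdim
  exact absurd (this.trans h1) (by decide)

/-- Ideals of a Noetherian local ring are closed. -/
lemma mem_of_forall_exists_sub_mem_pow {D : Type*} [CommRing D] [IsLocalRing D]
    [IsNoetherianRing D] {I : Ideal D} {g : D}
    (h : ∀ n : ℕ, ∃ r ∈ I, g - r ∈ maximalIdeal D ^ n) : g ∈ I := by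
  have hbot := Ideal.iInf_pow_smul_eq_bot_of_isLocalRing (M := D ⧸ I) (maximalIdeal D)
    (Ideal.IsPrime.ne_top inferInstance)
  have hg : Ideal.Quotient.mk I g ∈
      (⨅ n : ℕ, maximalIdeal D ^ n • ⊤ : Submodule D (D ⧸ I)) := by
    rw [Submodule.mem_iInf]
    intro n
    obtain ⟨r, hr, hgr⟩ := h n
    have : Ideal.Quotient.mk I g = (g - r) • (1 : D ⧸ I) := by
      rw [Algebra.smul_def, mul_one]
      exact Ideal.Quotient.eq.2 (by simpa using hr)
    rw [this]
    exact Submodule.smul_mem_smul hgr trivial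
  rw [hbot] at hg
  exact Ideal.Quotient.eq_zero_iff_mem.1 hg

/-- Modulo `x` the maximal ideal is generated by `y`: as long as the coefficient of `y ^ n` is a
nonunit, another factor `y` splits off. If this never stopped, `a` would lie in `(x) + 𝔪 ^ n` for
all `n`, hence in `(x)`. -/
lemma exists_unit_mul_pow_add {D : Type*} [CommRing D] [IsLocalRing D] [IsNoetherianRing D]
    {x y : D} (h : IsRSP x y) {a : D} (ha : ¬ x ∣ a) :
    ∃ (n : ℕ) (u s : D), IsUnit u ∧ a = u * y ^ n + x * s := by
  by_contra! hcon
  have key : ∀ n : ℕ, ∃ t s : D, a = t * y ^ n + x * s := by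
    intro n
    induction n with
    | zero => exact ⟨a, 0, by simp⟩
    | succ n ih =>
      obtain ⟨t, s, hts⟩ := ih
      by_cases ht : IsUnit t
      · exact absurd hts (hcon n t s ht)
      · have htm : t ∈ Ideal.span {x, y} := by rw [h]; exact ht
        obtain ⟨c, d, rfl⟩ := Ideal.mem_span_pair.1 htm
        exact ⟨d, s + c * y ^ n, by rw [hts]; ring⟩
  have hym : y ∈ maximalIdeal D := h ▸ Ideal.subset_span (by simp)
  refine ha (Ideal.mem_span_singleton.1 (mem_of_forall_exists_sub_mem_pow fun n => ?_))
  obtain ⟨t, s, hts⟩ := key n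
  refine ⟨x * s, Ideal.mem_span_singleton.2 (dvd_mul_right _ _), ?_⟩
  rw [hts, add_sub_cancel_right]
  exact Ideal.mul_mem_left _ _ (Ideal.pow_mem_pow hym n)

lemma IsRSP.prime {D : Type*} [CommRing D] [IsLocalRing D] [IsNoetherianRing D] [IsDomain D]
    (hdim : 2 ≤ ringKrullDim D) {x y : D} (h : IsRSP x y) : Prime x := by
  have hxm : x ∈ maximalIdeal D := h ▸ Ideal.subset_span (by simp)
  refine ⟨?_, hxm, fun a b hab => ?_⟩
  · rintro rfl
    have hy0 : y ≠ 0 := by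
      rintro rfl
      exact h.not_dvd_pow hdim 1 (by simp)
    have h' : IsRSP y (0 : D) := by rw [IsRSP, Set.pair_comm]; exact h
    exact h'.not_dvd_pow hdim 1 (by simp)
  · by_contra! hcon
    obtain ⟨n, u, s, hu, rfl⟩ := exists_unit_mul_pow_add h hcon.1
    obtain ⟨m, v, t, hv, rfl⟩ := exists_unit_mul_pow_add h hcon.2
    apply h.not_dvd_pow hdim (n + m)
    have : x ∣ (u * v) * y ^ (n + m) := by
      have h2 : (u * v) * y ^ (n + m) = (u * y ^ n + x * s) * (v * y ^ m + x * t)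
          - x * (s * (v * y ^ m + x * t) + u * y ^ n * t) := by ring
      rw [h2]
      exact dvd_sub hab (dvd_mul_right _ _)
    exact (hu.mul hv).dvd_mul_left.1 this

/-- As `x` is prime and divides no power of `y`, one can cancel `x ^ a`, and then `y ^ b` modulo
`x`. -/
lemma IsRSP.mem_of_mul_mem_of_isDomain {D : Type*} [CommRing D] [IsLocalRing D]
    [IsNoetherianRing D] [IsDomain D] (hdim : 2 ≤ ringKrullDim D) {x y : D} (h : IsRSP x y)
    {r : D} {a b : ℕ} (hr : r * (x ^ a * y ^ b) ∈ Ideal.span {x ^ (a + 1), y ^ (b + 1)}) :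
    r ∈ maximalIdeal D := by
  have hx := h.prime hdim
  obtain ⟨s, t, hst⟩ := Ideal.mem_span_pair.1 hr
  have h1 : x ^ a ∣ t * y ^ (b + 1) := ⟨r * y ^ b - s * x, by linear_combination hst⟩
  obtain ⟨t, rfl⟩ := hx.pow_dvd_of_dvd_mul_right a (h.not_dvd_pow hdim _) h1
  have h2 : x ^ a * (s * x + t * y ^ (b + 1)) = x ^ a * (r * y ^ b) := by
    linear_combination hst
  have h3 := mul_left_cancel₀ (pow_ne_zero a hx.ne_zero) h2
  have h4 : x ∣ (r - t * y) * y ^ b := ⟨s, by linear_combination -h3⟩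
  obtain ⟨c, hc⟩ := (hx.dvd_or_dvd h4).resolve_right (h.not_dvd_pow hdim _)
  rw [← h, Ideal.mem_span_pair]
  exact ⟨c, t, by linear_combination -hc⟩

/-- `P` is the bottom of a chain of primes of length two; the whole chain survives in the quotient.
This reduces independence of monomials to domains. -/
lemma exists_prime_le_ringKrullDim_quotient {O : Type*} [CommRing O]
    (hdim : 2 ≤ ringKrullDim O) :
    ∃ P : Ideal O, P.IsPrime ∧ 2 ≤ ringKrullDim (O ⧸ P) := by
  obtain ⟨l, hl⟩ := Order.le_krullDim_iff.1 (show ((2 : ℕ) : WithBot ℕ∞) ≤ _ from hdim)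
  refine ⟨l.head.asIdeal, l.head.isPrime, ?_⟩
  rw [ringKrullDim_quotient]
  change ((2 : ℕ) : WithBot ℕ∞) ≤ _
  rw [Order.le_krullDim_iff]
  refine ⟨⟨l.length, fun i => ⟨l i, ?_⟩, fun i => l.step i⟩, hl⟩
  rw [PrimeSpectrum.mem_zeroLocus, SetLike.coe_subset_coe]
  exact LTSeries.head_le l i

/-- Monomials in a regular system of parameters of a two-dimensional ring are independent modulo
the maximal ideal. -/
lemma IsRSP.mem_of_mul_mem {O : Type*} [CommRing O] [IsLocalRing O]
    [IsNoetherianRing O] (hdim : 2 ≤ ringKrullDim O) {x y : O} (h : IsRSP x y)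
    {r : O} {a b : ℕ} (hr : r * (x ^ a * y ^ b) ∈ Ideal.span {x ^ (a + 1), y ^ (b + 1)}) :
    r ∈ maximalIdeal O := by
  obtain ⟨P, hP, hPd⟩ := exists_prime_le_ringKrullDim_quotient hdim
  have hsurj : Function.Surjective (Ideal.Quotient.mk P) := Ideal.Quotient.mk_surjective
  have : IsLocalRing (O ⧸ P) := IsLocalRing.of_surjective' _ hsurj
  have hloc : IsLocalHom (Ideal.Quotient.mk P) := hsurj.isLocalHom
  have hmap : (maximalIdeal O).map (Ideal.Quotient.mk P) = maximalIdeal (O ⧸ P) := IsLocalRing.map_maximalIdeal_of_surjective _ hsurj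
  have h' : IsRSP (Ideal.Quotient.mk P x) (Ideal.Quotient.mk P y) := by
    rw [IsRSP, ← hmap, ← h, Ideal.map_span, Set.image_pair]
  have h2 := h'.mem_of_mul_mem_of_isDomain hPd (r := Ideal.Quotient.mk P r) (a := a) (b := b) (by
    have := Ideal.mem_map_of_mem (Ideal.Quotient.mk P) hr
    rw [Ideal.map_span, Set.image_pair] at this
    simpa using this)
  intro hu
  exact h2 (hu.map _)

end RegularSequence

end PlaneCurve
namespace PlaneCurve

/-! ### Weight filtrations -/

section WeightIdeal

variable {O : Type*} [CommRing O]

/-- The monomial ideal in `x`, `y` of the exponents of weight at least `t`, where `x` has weight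
`α` and `y` has weight `β`. -/
def weightIdeal (x y : O) (α β t : ℝ) : Ideal O :=
  Ideal.span {g | ∃ a b : ℕ, t ≤ a * α + b * β ∧ g = x ^ a * y ^ b}

variable {x y x' y' g : O} {α β α' β' s t : ℝ}

lemma monomial_mem_weightIdeal {a b : ℕ} (h : t ≤ a * α + b * β) :
    x ^ a * y ^ b ∈ weightIdeal x y α β t :=
  Ideal.subset_span ⟨a, b, h, rfl⟩

lemma weightIdeal_le {I : Ideal O}
    (h : ∀ a b : ℕ, t ≤ a * α + b * β → x ^ a * y ^ b ∈ I) : weightIdeal x y α β t ≤ I := by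
  rw [weightIdeal, Ideal.span_le]
  rintro _ ⟨a, b, hab, rfl⟩
  exact h a b hab

lemma weightIdeal_comm : weightIdeal x y α β t = weightIdeal y x β α t := by
  apply le_antisymm <;> refine weightIdeal_le fun a b h => ?_ <;> rw [mul_comm] <;>
    exact monomial_mem_weightIdeal (by linarith)

lemma left_mem_weightIdeal (h : t ≤ α) : x ∈ weightIdeal x y α β t := by
  have := monomial_mem_weightIdeal (x := x) (y := y) (α := α) (β := β) (t := t) (a := 1) (b := 0)
    (by simpa using h)
  simpa using this

lemma right_mem_weightIdeal (h : t ≤ β) : y ∈ weightIdeal x y α β t := by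
  rw [weightIdeal_comm]; exact left_mem_weightIdeal h

lemma weightIdeal_mul_le :
    weightIdeal x y α β s * weightIdeal x y α β t ≤ weightIdeal x y α β (s + t) := by
  rw [weightIdeal, weightIdeal, Ideal.span_mul_span', Ideal.span_le]
  rintro _ ⟨_, ⟨a, b, h, rfl⟩, _, ⟨c, d, h', rfl⟩, rfl⟩
  have : x ^ a * y ^ b * (x ^ c * y ^ d) = x ^ (a + c) * y ^ (b + d) := by ring
  simp only [SetLike.mem_coe, this]
  apply monomial_mem_weightIdeal
  push_cast
  linarith

lemma weightIdeal_pow_le (n : ℕ) :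
    weightIdeal x y α β t ^ n ≤ weightIdeal x y α β (n * t) := by
  induction n with
  | zero =>
    intro g _
    have : (1 : O) ∈ weightIdeal x y α β 0 := by
      simpa using monomial_mem_weightIdeal (x := x) (y := y) (α := α) (β := β) (t := 0)
        (a := 0) (b := 0) (by simp)
    simpa using Ideal.mul_mem_left _ g this
  | succ n ih =>
    rw [pow_succ]
    refine (Ideal.mul_mono_left ih).trans (weightIdeal_mul_le.trans (le_of_eq ?_))
    push_cast
    ring_nf

lemma weightIdeal_anti (h : s ≤ t) : weightIdeal x y α β t ≤ weightIdeal x y α β s :=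
  weightIdeal_le fun _ _ h' => monomial_mem_weightIdeal (h.trans h')

/-- The weight filtration of one pair is contained in that of another as soon as the generators
have at least the right weight. -/
lemma weightIdeal_le_weightIdeal (hx : x' ∈ weightIdeal x y α β α')
    (hy : y' ∈ weightIdeal x y α β β') :
    weightIdeal x' y' α' β' t ≤ weightIdeal x y α β t := by
  refine weightIdeal_le fun a b h => weightIdeal_anti h ?_
  exact weightIdeal_mul_le (Ideal.mul_mem_mul (weightIdeal_pow_le a (Ideal.pow_mem_pow hx a))
    (weightIdeal_pow_le b (Ideal.pow_mem_pow hy b)))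

variable [IsLocalRing O]

lemma IsRSP.symm (h : IsRSP x y) : IsRSP y x := by
  rw [IsRSP, Set.pair_comm]; exact h

lemma IsRSP.left_mem (h : IsRSP x y) : x ∈ maximalIdeal O := h ▸ Ideal.subset_span (by simp)

lemma IsRSP.right_mem (h : IsRSP x y) : y ∈ maximalIdeal O := h.symm.left_mem

lemma IsRSP.maximalIdeal_le_weightIdeal (h : IsRSP x y) (hα : t ≤ α) (hβ : t ≤ β) :
    maximalIdeal O ≤ weightIdeal x y α β t := by
  rw [← h, Ideal.span_le]
  rintro _ (rfl | rfl)
  · exact left_mem_weightIdeal hα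
  · exact right_mem_weightIdeal hβ

lemma IsRSP.pow_le_weightIdeal (h : IsRSP x y) (hα : s ≤ α) (hβ : s ≤ β) {n : ℕ}
    (hn : t ≤ n * s) : maximalIdeal O ^ n ≤ weightIdeal x y α β t :=
  (Ideal.pow_right_mono (h.maximalIdeal_le_weightIdeal hα hβ) n).trans
    ((weightIdeal_pow_le n).trans (weightIdeal_anti hn))

lemma IsRSP.monomial_mem_pow (h : IsRSP x y) {a b n : ℕ} (hn : n ≤ a + b) :
    x ^ a * y ^ b ∈ maximalIdeal O ^ n := by
  refine Ideal.pow_le_pow_right hn ?_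
  rw [pow_add]
  exact Ideal.mul_mem_mul (Ideal.pow_mem_pow h.left_mem a) (Ideal.pow_mem_pow h.right_mem b)

lemma IsRSP.weightIdeal_le_pow (h : IsRSP x y) {n : ℕ}
    (hn : ∀ a b : ℕ, t ≤ a * α + b * β → n ≤ a + b) :
    weightIdeal x y α β t ≤ maximalIdeal O ^ n :=
  weightIdeal_le fun a b hab => h.monomial_mem_pow (hn a b hab)

lemma IsRSP.pow_le_span (h : IsRSP x y) (a b : ℕ) :
    maximalIdeal O ^ (a + b + 1) ≤ Ideal.span {x ^ (a + 1), y ^ (b + 1)} := by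
  refine (h.pow_le_weightIdeal (s := 1) (t := (a + b + 1 : ℕ)) le_rfl le_rfl
    (by simp)).trans (weightIdeal_le fun i j hij => ?_)
  rw [mul_one, mul_one] at hij
  have h3 : a + b + 1 ≤ i + j := by exact_mod_cast hij
  rcases (by omega : a + 1 ≤ i ∨ b + 1 ≤ j) with h1 | h1
  · exact Ideal.mul_mem_right _ _ (Ideal.mem_of_dvd _ (pow_dvd_pow x h1)
      (Ideal.subset_span (by simp)))
  · exact Ideal.mul_mem_left _ _ (Ideal.mem_of_dvd _ (pow_dvd_pow y h1)
      (Ideal.subset_span (by simp)))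

end WeightIdeal

/-! ### Expansions and their exponents -/

section Expansion

variable {k O : Type*} [Field k] [CommRing O] [IsLocalRing O] [Algebra k O] {x y g : O}

lemma IsRSP.exists_sum_of_mem_pow (h : IsRSP x y) {n : ℕ} (hg : g ∈ maximalIdeal O ^ n) :
    ∃ r : ℕ × ℕ → O, g = ∑ p ∈ Finset.HasAntidiagonal.antidiagonal n,
      r p * (x ^ p.1 * y ^ p.2) := by
  induction n generalizing g with
  | zero => exact ⟨fun _ => g, by simp⟩
  | succ n ih =>
    rw [pow_succ'] at hg
    induction hg using Submodule.mul_induction_on' with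
    | mem_mul_mem u hu v hv =>
      obtain ⟨r, rfl⟩ := ih hv
      rw [← h] at hu
      obtain ⟨c, d, rfl⟩ := Ideal.mem_span_pair.1 hu
      refine ⟨fun p => c * (if p.1 = 0 then 0 else r (p.1 - 1, p.2)) +
        d * (if p.2 = 0 then 0 else r (p.1, p.2 - 1)), ?_⟩
      simp only [add_mul, Finset.sum_add_distrib]
      congr 1
      · rw [Finset.Nat.sum_antidiagonal_succ, Finset.mul_sum]
        simp only [if_true, mul_zero, zero_mul, zero_add, Nat.succ_ne_zero, if_false,
          Nat.add_sub_cancel]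
        exact Finset.sum_congr rfl fun p _ => by ring
      · rw [Finset.Nat.sum_antidiagonal_succ', Finset.mul_sum]
        simp only [if_true, mul_zero, zero_mul, zero_add, Nat.succ_ne_zero, if_false,
          Nat.add_sub_cancel]
        exact Finset.sum_congr rfl fun p _ => by ring
    | add u hu v hv iu iv =>
      obtain ⟨r, rfl⟩ := iu
      obtain ⟨r', rfl⟩ := iv
      exact ⟨fun p => r p + r' p, by simp only [add_mul, Finset.sum_add_distrib]⟩

/-- The membership hypothesis stands inside the existential so that `choose` yields coefficients for
all `g` and `n`. -/
lemma IsRSP.exists_coeff_of_mem_pow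
    (hk : Function.Surjective (algebraMap k (ResidueField O))) (h : IsRSP x y) (g : O) (n : ℕ) :
    ∃ c : ℕ × ℕ → k, g ∈ maximalIdeal O ^ n →
      g - ∑ p ∈ Finset.HasAntidiagonal.antidiagonal n,
        algebraMap k O (c p) * (x ^ p.1 * y ^ p.2) ∈ maximalIdeal O ^ (n + 1) := by
  by_cases hg : g ∈ maximalIdeal O ^ n
  · obtain ⟨r, hr⟩ := h.exists_sum_of_mem_pow hg
    choose c hc using fun p => hk (residue O (r p))
    refine ⟨c, fun _ => ?_⟩
    rw [hr, ← Finset.sum_sub_distrib]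
    refine Ideal.sum_mem _ fun p hp => ?_
    rw [← sub_mul, pow_succ']
    refine Ideal.mul_mem_mul ?_ (h.monomial_mem_pow (Finset.HasAntidiagonal.mem_antidiagonal.1 hp).ge)
    rw [← residue_eq_zero_iff, map_sub, ← hc p, IsScalarTower.algebraMap_apply k O (ResidueField O)]
    exact sub_self _
  · exact ⟨0, fun h' => absurd h' hg⟩

lemma IsRSP.exists_isExpansion
    (hk : Function.Surjective (algebraMap k (ResidueField O))) (h : IsRSP x y) (g : O) :
    ∃ c, IsExpansion k x y g c := by
  choose C hC using fun (g : O) (n : ℕ) => h.exists_coeff_of_mem_pow hk g n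
  -- `rem n` is what remains of `g` once the terms of degree below `n` are subtracted.
  let rem : ℕ → O := fun n => Nat.rec g (fun n g' => g' -
    ∑ p ∈ Finset.HasAntidiagonal.antidiagonal n,
        algebraMap k O (C g' n p) * (x ^ p.1 * y ^ p.2)) n
  have hrem : ∀ n, rem n ∈ maximalIdeal O ^ n := by
    intro n
    induction n with
    | zero => simp
    | succ n ih => exact hC (rem n) n ih
  refine ⟨fun p => C (rem (p.1 + p.2)) (p.1 + p.2) p, fun n => ?_⟩
  convert hrem n using 1
  induction n with
  | zero => simp [rem]
  | succ n ih =>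
    rw [Finset.sum_range_succ, ← sub_sub, ih]
    change _ = rem n - _
    congr 1
    refine Finset.sum_congr rfl fun p hp => ?_
    obtain rfl := Finset.HasAntidiagonal.mem_antidiagonal.1 hp
    rfl

/-- Membership in a monomial ideal can be read off from the exponents of an expansion. -/
lemma IsRSP.mem_weightIdeal_iff [IsNoetherianRing O] (hdim : 2 ≤ ringKrullDim O)
    (hk : Function.Surjective (algebraMap k (ResidueField O))) (h : IsRSP x y)
    {α β t : ℝ} (hα : 0 < α) (hβ : 0 < β) :
    g ∈ weightIdeal x y α β t ↔ ∀ p ∈ expSupport k x y g, t ≤ p.1 * α + p.2 * β := by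
  constructor
  · rintro hg p ⟨c, hc, hcp⟩
    by_contra! hpt
    -- For a componentwise minimal exponent `(a, b)` below `p`, all other terms of the expansion
    -- vanish modulo `(x ^ (a + 1), y ^ (b + 1))`, as does the weight ideal. So `c (a, b) x ^ a y ^
    -- b` lies in that ideal, against independence.
    obtain ⟨⟨a, b⟩, ⟨hab, habp⟩, hmin⟩ := wellFounded_lt.has_min
      {q : ℕ × ℕ | c q ≠ 0 ∧ q ≤ p} ⟨p, hcp, le_rfl⟩
    set I := Ideal.span {x ^ (a + 1), y ^ (b + 1)} with hI
    have hmono : ∀ i j : ℕ, ¬ (i, j) ≤ (a, b) → x ^ i * y ^ j ∈ I := by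
      intro i j hij
      have : a + 1 ≤ i ∨ b + 1 ≤ j := by
        by_contra! hcon
        exact hij ⟨by simpa using hcon.1, by simpa using hcon.2⟩
      rcases this with h1 | h1
      · exact Ideal.mul_mem_right _ _ (Ideal.mem_of_dvd _ (pow_dvd_pow x h1)
          (Ideal.subset_span (by simp)))
      · exact Ideal.mul_mem_left _ _ (Ideal.mem_of_dvd _ (pow_dvd_pow y h1)
          (Ideal.subset_span (by simp)))
    have hW : weightIdeal x y α β t ≤ I := by
      refine weightIdeal_le fun i j hij => hmono i j fun hle => ?_
      have h1 : (i : ℝ) ≤ p.1 := by exact_mod_cast hle.1.trans habp.1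
      have h2 : (j : ℝ) ≤ p.2 := by exact_mod_cast hle.2.trans habp.2
      nlinarith
    have hm : maximalIdeal O ^ (a + b + 1) ≤ I := h.pow_le_span a b
    have hsum := I.sub_mem (hW hg) (hm (hc (a + b + 1)))
    rw [sub_sub_cancel, ← Ideal.Quotient.eq_zero_iff_mem, map_sum,
      Finset.sum_eq_single (a + b), map_sum, Finset.sum_eq_single (a, b),
      Ideal.Quotient.eq_zero_iff_mem] at hsum
    · exact h.mem_of_mul_mem hdim hsum ((IsUnit.mk0 _ hab).map (algebraMap k O))
    · rintro ⟨i, j⟩ hij hne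
      rw [Ideal.Quotient.eq_zero_iff_mem]
      refine Ideal.mul_mem_left _ _ (hmono i j fun hle => hne ?_)
      have h0 := Finset.HasAntidiagonal.mem_antidiagonal.1 hij
      have h1 : i ≤ a := hle.1
      have h2 : j ≤ b := hle.2
      simp only at h0
      ext <;> simp only <;> omega
    · simp
    · intro d hd hne
      rw [map_sum]
      refine Finset.sum_eq_zero fun q hq => ?_
      rw [Ideal.Quotient.eq_zero_iff_mem]
      by_cases hcq : c q = 0
      · simp [hcq]
      refine Ideal.mul_mem_left _ _ (hmono _ _ fun hle => ?_)
      refine hmin q ⟨hcq, hle.trans habp⟩ (lt_of_le_of_ne hle ?_)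
      rintro rfl
      exact hne (Finset.HasAntidiagonal.mem_antidiagonal.1 hq).symm
    · simp
  · intro hp
    obtain ⟨c, hc⟩ := h.exists_isExpansion hk g
    -- In degree `n` and above every monomial has weight at least `t`, so a truncation suffices.
    obtain ⟨n, hn⟩ := exists_nat_ge (t / min α β)
    have hmin : 0 < min α β := lt_min hα hβ
    have h1 := h.pow_le_weightIdeal (min_le_left α β) (min_le_right α β)
      ((div_le_iff₀ hmin).1 hn) (hc n)
    rw [← sub_add_cancel g (∑ d ∈ Finset.range n, _)]
    refine Ideal.add_mem _ h1 (Ideal.sum_mem _ fun d _ => Ideal.sum_mem _ fun p _ => ?_)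
    by_cases hcp : c p = 0
    · simp [hcp]
    · exact Ideal.mul_mem_left _ _ (monomial_mem_weightIdeal (hp p ⟨c, hc, hcp⟩))

end Expansion

end PlaneCurve
namespace PlaneCurve

/-! ### Tangent directions and comparison of parameters -/

section Tangent

variable {O : Type*} [CommRing O] [IsLocalRing O] [IsNoetherianRing O]
  {f x y z w : O} {α β t : ℝ} {n : ℕ}

lemma mem_pow_order (hf : f ≠ 0) : f ∈ maximalIdeal O ^ order f ∧
    f ∉ maximalIdeal O ^ (order f + 1) := by
  have hne : {n : ℕ | f ∈ maximalIdeal O ^ n}.Nonempty := ⟨0, by simp⟩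
  have hbdd : BddAbove {n : ℕ | f ∈ maximalIdeal O ^ n} := by
    by_contra hcon
    rw [not_bddAbove_iff] at hcon
    refine hf ((Ideal.mem_bot).1 (mem_of_forall_exists_sub_mem_pow fun n => ⟨0, zero_mem _, ?_⟩))
    obtain ⟨m, hm, hnm⟩ := hcon n
    rw [sub_zero]
    exact Ideal.pow_le_pow_right hnm.le hm
  refine ⟨Nat.sSup_mem hne hbdd, fun h => ?_⟩
  have : order f + 1 ≤ order f := le_csSup hbdd h
  omega

omit [IsLocalRing O] [IsNoetherianRing O] in
lemma exists_sub_mul_pow_mem {I : Ideal O} (hf : f ∈ weightIdeal y w α β t)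
    (hI : ∀ i j : ℕ, i < n → t ≤ i * α + j * β → y ^ i * w ^ j ∈ I) :
    ∃ r : O, f - r * y ^ n ∈ I := by
  have hle : weightIdeal y w α β t ≤ Ideal.span {y ^ n} ⊔ I := by
    refine weightIdeal_le fun i j hij => ?_
    rcases lt_or_ge i n with h | h
    · exact Ideal.mem_sup_right (hI i j h hij)
    · exact Ideal.mem_sup_left (Ideal.mul_mem_right _ _
        (Ideal.mem_span_singleton.2 (pow_dvd_pow y h)))
  obtain ⟨u, hu, g, hg, rfl⟩ := Submodule.mem_sup.1 (hle hf)
  obtain ⟨r, rfl⟩ := Ideal.mem_span_singleton.1 hu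
  exact ⟨r, by rwa [mul_comm r, add_sub_cancel_left]⟩

omit [IsNoetherianRing O] in
lemma isUnit_of_sub_mul_pow_mem {r : O} (hf : f ∉ maximalIdeal O ^ (n + 1))
    (hy : y ∈ maximalIdeal O) (h : f - r * y ^ n ∈ maximalIdeal O ^ (n + 1)) : IsUnit r := by
  by_contra hr
  apply hf
  rw [← sub_add_cancel f (r * y ^ n)]
  refine Ideal.add_mem _ h ?_
  rw [pow_succ']
  exact Ideal.mul_mem_mul hr (Ideal.pow_mem_pow hy n)

/-- Since the second weight is strictly below `1 / n`, trading first factors for second ones costs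
weight. Thus the part of weight at least one is `r y ^ n` modulo `𝔪 ^ (n + 1)`. -/
lemma lt_add_of_one_le (hn : 1 ≤ n) (hβ : β < (n : ℝ)⁻¹) {i j : ℕ} (hi : i < n)
    (h : 1 ≤ i * (n : ℝ)⁻¹ + j * β) : n + 1 ≤ i + j := by
  have hn0 : (0 : ℝ) < n := by exact_mod_cast hn
  have hi' : (i : ℝ) < n := by exact_mod_cast hi
  have hinv : (n : ℝ) * (n : ℝ)⁻¹ = 1 := mul_inv_cancel₀ hn0.ne'
  have hpos : (0 : ℝ) < (n : ℝ)⁻¹ := inv_pos.2 hn0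
  rcases Nat.eq_zero_or_pos j with rfl | hj
  · simp only [Nat.cast_zero, zero_mul, add_zero] at h
    nlinarith
  · have hj' : (0 : ℝ) < j := by exact_mod_cast hj
    have h1 : (n : ℝ) * (n : ℝ)⁻¹ < (i + j) * (n : ℝ)⁻¹ := by
      rw [hinv]
      nlinarith
    have h2 : (n : ℝ) < i + j := lt_of_mul_lt_mul_right h1 hpos.le
    exact_mod_cast h2

omit [IsLocalRing O] [IsNoetherianRing O] in
lemma exists_mul_add_pow (c d z x : O) (n : ℕ) :
    ∃ s, (c * z + d * x) ^ n = z * s + d ^ n * x ^ n := by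
  obtain ⟨s, hs⟩ := sub_dvd_pow_sub_pow (c * z + d * x) (d * x) n
  exact ⟨c * s, by linear_combination hs - mul_pow d x n⟩

/-- Two parameters with proportional `n`-th powers modulo `𝔪 ^ (n + 1)` are transversal to the same
parameters. -/
lemma IsRSP.of_sub_mem_pow (hdim : 2 ≤ ringKrullDim O) (hxz : IsRSP x z) (hyw : IsRSP y w)
    {r s : O} (hr : IsUnit r) (hn : 1 ≤ n)
    (h : r * y ^ n - s * z ^ n ∈ maximalIdeal O ^ (n + 1)) : IsRSP x y := by
  have hy := hyw.left_mem
  rw [← hxz.symm, Ideal.mem_span_pair] at hy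
  obtain ⟨d, c, hdc⟩ := hy
  obtain ⟨q, hq⟩ := exists_mul_add_pow d c z x n
  have hz : ∀ g, z * g ∈ Ideal.span {x ^ (n + 1), z ^ (0 + 1)} := fun g =>
    Ideal.mul_mem_right _ _ (Ideal.subset_span (by simp))
  have hc : r * c ^ n ∈ maximalIdeal O := by
    -- Modulo `z`, the hypothesis reads `r c ^ n x ^ n ∈ (x ^ (n + 1))`.
    refine hxz.mem_of_mul_mem hdim (a := n) (b := 0) ?_
    have h1 := hxz.pow_le_span n 0 h
    obtain ⟨m, rfl⟩ := Nat.exists_eq_add_of_le' hn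
    have h2 : r * c ^ (m + 1) * (x ^ (m + 1) * z ^ 0) =
        (r * y ^ (m + 1) - s * z ^ (m + 1)) + (z * (s * z ^ m - r * q)) := by
      rw [← hdc, hq]; ring
    rw [h2]
    exact Ideal.add_mem _ h1 (hz _)
  have hcm : c ∈ maximalIdeal O :=
    Ideal.IsPrime.mem_of_pow_mem inferInstance n
      ((Ideal.IsPrime.mem_or_mem inferInstance hc).resolve_left fun h' => h' hr)
  have hd : IsUnit d := by
    by_contra hd
    have hy2 : y ∈ maximalIdeal O ^ (1 + 0 + 1) := by
      rw [← hdc, show 1 + 0 + 1 = 2 from rfl, pow_two]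
      exact Ideal.add_mem _ (Ideal.mul_mem_mul hd hxz.right_mem)
        (Ideal.mul_mem_mul hcm hxz.left_mem)
    have h1 := hyw.mem_of_mul_mem hdim (r := 1) (a := 1) (b := 0)
      (by simpa using hyw.pow_le_span 1 0 hy2)
    exact h1 isUnit_one
  obtain ⟨e, he⟩ := hd.exists_left_inv
  refine le_antisymm ?_ ?_
  · rw [Ideal.span_le]
    rintro _ (rfl | rfl)
    · exact hxz.left_mem
    · exact hyw.left_mem
  · rw [← hxz, Ideal.span_le]
    refine Set.insert_subset_iff.2 ⟨Ideal.subset_span (by simp), Set.singleton_subset_iff.2 ?_⟩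
    refine Ideal.mem_span_pair.2 ⟨-(e * c), e, ?_⟩
    rw [← hdc]
    linear_combination z * he

/-- If `f` has the same large weight for `(z, x)` and `(y, x)`, then `y` has the same weight as `z`
for `(z, x)`. -/
lemma IsRSP.mem_weightIdeal_of_mem (hdim : 2 ≤ ringKrullDim O) (hxz : IsRSP x z)
    (hxy : IsRSP x y) (hn : 1 ≤ n) (hf : f ∉ maximalIdeal O ^ (n + 1)) (hβ0 : 0 < β)
    (hβ : β < (n : ℝ)⁻¹) (hz : f ∈ weightIdeal z x (n : ℝ)⁻¹ β 1)
    (hy : f ∈ weightIdeal y x (n : ℝ)⁻¹ β 1) :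
    y ∈ weightIdeal z x (n : ℝ)⁻¹ β (n : ℝ)⁻¹ := by
  have hn0 : (0 : ℝ) < n := by exact_mod_cast hn
  have hinv : (n : ℝ) * (n : ℝ)⁻¹ = 1 := mul_inv_cancel₀ hn0.ne'
  -- Write `y = c z + d x ^ e`. While `e β < 1 / n`, reducing `f` modulo `(z, x ^ (e n + 1))` leaves
  -- `r d ^ n x ^ (e n)` on one side and zero on the other, so `d ∈ 𝔪` and `e` can be raised. At the
  -- ceiling `x ^ e` has weight at least `1 / n`.
  have key : ∀ e : ℕ, e ≤ ⌈(n : ℝ)⁻¹ / β⌉₊ → y ∈ Ideal.span {z, x ^ e} := by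
    intro e
    induction e with
    | zero =>
      intro _
      exact Ideal.mem_span_pair.2 ⟨0, y, by simp⟩
    | succ e ih =>
      intro he
      have heβ : e * β < (n : ℝ)⁻¹ := (lt_div_iff₀ hβ0).1 (Nat.lt_ceil.1 he)
      obtain ⟨c, d, hcd⟩ := Ideal.mem_span_pair.1 (ih (by omega))
      set I := Ideal.span {x ^ (e * n + 1), z ^ (0 + 1)} with hI
      have hzI : ∀ g, z * g ∈ I := fun g =>
        Ideal.mul_mem_right _ _ (Ideal.subset_span (by simp))
      have hxI : ∀ m g, e * n + 1 ≤ m → g * x ^ m ∈ I := fun m g hm =>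
        Ideal.mul_mem_left _ _ (Ideal.mem_of_dvd _ (pow_dvd_pow x hm)
          (Ideal.subset_span (by simp)))
      have hbound : ∀ i j : ℕ, i < n → 1 ≤ i * (n : ℝ)⁻¹ + j * β → e * n + 1 ≤ e * i + j := by
        intro i j hi hij
        have hi' : (i : ℝ) < n := by exact_mod_cast hi
        have h1 : (n - i : ℝ) * (e * β) < (n - i) * (n : ℝ)⁻¹ :=
          mul_lt_mul_of_pos_left heβ (by linarith)
        have h2 : (e * n : ℝ) * β < (e * i + j) * β := by nlinarith
        have h3 := lt_of_mul_lt_mul_right h2 hβ0.le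
        exact_mod_cast h3
      have hfI : f ∈ I := by
        refine weightIdeal_le (fun i j hij => ?_) hz
        rcases Nat.eq_zero_or_pos i with rfl | hi
        · exact hxI _ _ (by simpa using hbound 0 j hn hij)
        · obtain ⟨i, rfl⟩ := Nat.exists_eq_add_of_le' hi
          rw [pow_succ', mul_assoc]
          exact hzI _
      obtain ⟨r, hr⟩ := exists_sub_mul_pow_mem (n := n) (I := I ⊓ maximalIdeal O ^ (n + 1)) hy
        (by
          intro i j hi hij
          refine ⟨?_, hxy.symm.monomial_mem_pow (lt_add_of_one_le hn hβ hi hij)⟩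
          obtain ⟨s, hs⟩ := exists_mul_add_pow c d z (x ^ e) i
          have h1 : y ^ i * x ^ j = z * (s * x ^ j) + d ^ i * x ^ (e * i + j) := by
            rw [← hcd, hs]; ring
          rw [h1]
          exact Ideal.add_mem _ (hzI _) (hxI _ _ (hbound i j hi hij)))
      have hru := isUnit_of_sub_mul_pow_mem hf hxy.right_mem hr.2
      obtain ⟨s, hs⟩ := exists_mul_add_pow c d z (x ^ e) n
      have hd : r * d ^ n ∈ maximalIdeal O := by
        refine hxz.mem_of_mul_mem hdim (a := e * n) (b := 0) ?_
        have h1 : r * d ^ n * (x ^ (e * n) * z ^ 0) = f - (f - r * y ^ n) - z * (r * s) := by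
          rw [← hcd, hs]; ring
        rw [h1]
        exact Ideal.sub_mem _ (Ideal.sub_mem _ hfI hr.1) (hzI _)
      have hdm : d ∈ maximalIdeal O :=
        Ideal.IsPrime.mem_of_pow_mem inferInstance n
          ((Ideal.IsPrime.mem_or_mem inferInstance hd).resolve_left fun h' => h' hru)
      rw [← hxz, Ideal.mem_span_pair] at hdm
      obtain ⟨p, q, rfl⟩ := hdm
      exact Ideal.mem_span_pair.2 ⟨c + q * x ^ e, p, by rw [← hcd]; ring⟩
  refine (Ideal.span_le.2 ?_ : Ideal.span {z, x ^ ⌈(n : ℝ)⁻¹ / β⌉₊} ≤ _) (key _ le_rfl)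
  rintro _ (rfl | rfl)
  · exact left_mem_weightIdeal le_rfl
  · simpa using monomial_mem_weightIdeal (x := z) (y := x) (α := (n : ℝ)⁻¹) (β := β) (a := 0)
      (b := ⌈(n : ℝ)⁻¹ / β⌉₊) (t := (n : ℝ)⁻¹)
      (by simpa using (div_le_iff₀ hβ0).1 (Nat.le_ceil _))

end Tangent

end PlaneCurve
namespace PlaneCurve

/-! ### Projected polyhedra as weight conditions -/

section Polyhedron

variable {k O : Type*} [Field k] [CommRing O] [IsLocalRing O] [IsNoetherianRing O] [Algebra k O]
  {f x y z w : O}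

lemma weight_iff {n : ℕ} (hn : 0 < n) {d : ℝ} (hd : 0 < d) (a b : ℝ) :
    1 ≤ a * ((n : ℝ) * d)⁻¹ + b * (n : ℝ)⁻¹ ↔ d * (n - b) ≤ a := by
  have hn0 : (0 : ℝ) < n := by exact_mod_cast hn
  have h : a * ((n : ℝ) * d)⁻¹ + b * (n : ℝ)⁻¹ = (a + b * d) / (n * d) := by
    field_simp
  rw [h, one_le_div (by positivity)]
  constructor <;> intro h' <;> nlinarith

lemma projectedPolyhedron_subset_Ici (hdim : 2 ≤ ringKrullDim O)
    (hk : Function.Surjective (algebraMap k (ResidueField O))) (h : IsRSP x y)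
    (hn : 0 < order f) {d : ℝ} (hd : 0 < d) :
    projectedPolyhedron k f x y ⊆ Set.Ici d ↔
      f ∈ weightIdeal y x (order f : ℝ)⁻¹ ((order f : ℝ) * d)⁻¹ 1 := by
  have hn0 : (0 : ℝ) < order f := by exact_mod_cast hn
  rw [weightIdeal_comm, h.mem_weightIdeal_iff hdim hk (by positivity) (by positivity),
    projectedPolyhedron]
  refine Iff.trans ⟨fun H => subset_closedConvexHull.trans H,
    fun H => closedConvexHull_min H (convex_Ici d) isClosed_Ici⟩ ?_
  simp only [Set.iUnion_subset_iff, Set.Ici_subset_Ici, weight_iff hn hd]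
  constructor
  · intro H p hp
    rcases lt_or_ge p.2 (order f) with hlt | hge
    · have hlt' : (p.2 : ℝ) < order f := by exact_mod_cast hlt
      exact (le_div_iff₀ (by linarith)).1 (H p ⟨hp, hlt⟩)
    · have hge' : (order f : ℝ) ≤ p.2 := by exact_mod_cast hge
      have : (0 : ℝ) ≤ p.1 := by positivity
      nlinarith
  · rintro H p ⟨hp, hlt⟩
    have hlt' : (p.2 : ℝ) < order f := by exact_mod_cast hlt
    exact (le_div_iff₀ (by linarith)).2 (H p hp)

/-- Otherwise `f` has weight at least `n` when `z` has weight one and `x` arbitrarily small weight,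
which puts `f` in `(z ^ n) + 𝔪 ^ N` for all `N`. This is what makes the polyhedron nonempty. -/
lemma exists_lt_of_not_dvd (hdim : 2 ≤ ringKrullDim O)
    (hk : Function.Surjective (algebraMap k (ResidueField O))) (h : IsRSP x z) {n : ℕ}
    (hf : ¬ z ^ n ∣ f) : ∃ p ∈ expSupport k x z f, p.2 < n := by
  by_contra! hcon
  refine hf (Ideal.mem_span_singleton.1 (mem_of_forall_exists_sub_mem_pow fun N => ?_))
  have hN : (0 : ℝ) < ((N : ℝ) + 1)⁻¹ := by positivity
  have hmem : f ∈ weightIdeal x z ((N : ℝ) + 1)⁻¹ 1 n := by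
    refine (h.mem_weightIdeal_iff hdim hk hN one_pos).2 fun p hp => ?_
    have : (n : ℝ) ≤ p.2 := by exact_mod_cast hcon p hp
    have : (0 : ℝ) ≤ p.1 * ((N : ℝ) + 1)⁻¹ := by positivity
    linarith
  rw [weightIdeal_comm] at hmem
  obtain ⟨r, hr⟩ := exists_sub_mul_pow_mem (n := n) (I := maximalIdeal O ^ N) hmem
    (by
      intro i j hi hij
      have hi' : (i : ℝ) + 1 ≤ n := by exact_mod_cast hi
      have h1 : (1 : ℝ) ≤ j * ((N : ℝ) + 1)⁻¹ := by linarith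
      rw [← div_eq_mul_inv, one_le_div (by positivity)] at h1
      have h2 : N + 1 ≤ j := by exact_mod_cast h1
      exact h.symm.monomial_mem_pow (by omega))
  exact ⟨r * z ^ n, Ideal.mul_mem_left _ _ (Ideal.mem_span_singleton_self _), hr⟩

omit [IsNoetherianRing O] in
/-- A projected polyhedron is a ray with rational vertex, unless it is empty. -/
lemma exists_projectedPolyhedron_eq_Ici
    (hne : ∃ p ∈ expSupport k x z f, p.2 < order f) :
    ∃ δ : ℚ, projectedPolyhedron k f x z = Set.Ici (δ : ℝ) := by
  set n := order f with hn
  -- Multiplying by `n!` clears all denominators `n - b`, so the infinitely many endpoints have a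
  -- minimum.
  let N : ℕ × ℕ → ℕ := fun p => p.1 * (n.factorial / (n - p.2))
  have hN : ∀ p : ℕ × ℕ, p.2 < n → (N p : ℝ) = n.factorial * ((p.1 : ℝ) / ((n : ℝ) - p.2)) := by
    intro p hp
    have h1 : n - p.2 ∣ n.factorial := Nat.dvd_factorial (by omega) (by omega)
    have h2 : ((n - p.2 : ℕ) : ℝ) ≠ 0 := by
      rw [Nat.cast_ne_zero]; omega
    rw [← Nat.cast_sub hp.le]
    simp only [N]
    rw [Nat.cast_mul, Nat.cast_div h1 h2]
    ring
  obtain ⟨p, ⟨hp, hpn⟩, hmin⟩ := (InvImage.wf N wellFounded_lt).has_min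
    {p ∈ expSupport k x z f | p.2 < n} (by obtain ⟨p, hp⟩ := hne; exact ⟨p, hp⟩)
  refine ⟨(p.1 : ℚ) / ((n : ℚ) - (p.2 : ℚ)), ?_⟩
  push_cast
  refine Set.Subset.antisymm ?_ ?_
  · refine closedConvexHull_min ?_ (convex_Ici _) isClosed_Ici
    refine Set.iUnion₂_subset fun q hq => Set.Ici_subset_Ici.2 ?_
    have h1 : (N p : ℝ) ≤ N q := by exact_mod_cast not_lt.1 (hmin q hq)
    rw [hN p hpn, hN q hq.2] at h1
    exact le_of_mul_le_mul_left h1 (by positivity)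
  · refine Set.Subset.trans ?_ (subset_closedConvexHull)
    exact Set.subset_iUnion₂_of_subset p ⟨hp, hpn⟩ subset_rfl

end Polyhedron

/-! ### Centers as filtrations -/

section Center

variable {k O : Type*} [Field k] [CommRing O] [IsLocalRing O] [IsNoetherianRing O] [Algebra k O]
  {f x y z w : O}

/-- The ideal of elements of value at least `t` for the monomial valuation of a center. -/
noncomputable def Center.ideal (J : Center O) (t : ℝ) : Ideal O :=
  weightIdeal J.x₁ J.x₂ (J.a₁ : ℝ)⁻¹ (J.a₂ : ℝ)⁻¹ t

omit [IsNoetherianRing O] in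
lemma Center.inv_pos (J : Center O) : (0 : ℝ) < (J.a₁ : ℝ)⁻¹ ∧ (0 : ℝ) < (J.a₂ : ℝ)⁻¹ := by
  have h1 := J.a₁_pos
  have h2 := h1.trans_le J.a₁_le_a₂
  exact ⟨_root_.inv_pos.2 (by exact_mod_cast h1), _root_.inv_pos.2 (by exact_mod_cast h2)⟩

lemma Center.le_val_iff (hdim : 2 ≤ ringKrullDim O)
    (hk : Function.Surjective (algebraMap k (ResidueField O))) (J : Center O) (g : O) (t : ℝ) :
    (t : EReal) ≤ J.val k g ↔ g ∈ J.ideal t := by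
  rw [Center.ideal, J.isRSP.mem_weightIdeal_iff hdim hk J.inv_pos.1 J.inv_pos.2, Center.val]
  simp only [le_iInf_iff, EReal.coe_le_coe_iff, div_eq_mul_inv]

lemma Center.admissible_iff (hdim : 2 ≤ ringKrullDim O)
    (hk : Function.Surjective (algebraMap k (ResidueField O))) (J : Center O) :
    J.Admissible k f ↔ f ∈ J.ideal 1 := by
  rw [← J.le_val_iff hdim hk]
  rfl

/-- An extended real is determined by the real numbers below it, so the ideals of a center determine
its valuation. -/
lemma Center.val_eq_of_ideal_eq (hdim : 2 ≤ ringKrullDim O)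
    (hk : Function.Surjective (algebraMap k (ResidueField O))) {J J' : Center O}
    (h : J.ideal = J'.ideal) : J.val k = J'.val k := by
  have key : ∀ (I I' : Center O), I.ideal = I'.ideal → ∀ g, I.val k g ≤ I'.val k g := by
    intro I I' hI g
    refine EReal.ge_of_forall_gt_iff_ge.1 fun t ht => ?_
    rw [I'.le_val_iff hdim hk, ← hI, ← I.le_val_iff hdim hk]
    exact ht.le
  exact funext fun g => le_antisymm (key J J' h g) (key J' J h.symm g)

end Center

end PlaneCurve
namespace PlaneCurve

/-! ### Adapted parameters and maximality -/

section Adapted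

variable {k O : Type*} [Field k] [CommRing O] [IsLocalRing O] [IsNoetherianRing O] [Algebra k O]
  {f x y z w : O}

lemma order_pos (hf0 : f ≠ 0) (hf : f ∈ maximalIdeal O) : 1 ≤ order f := by
  by_contra! h
  have := (mem_pow_order hf0).2
  rw [show order f = 0 by omega, zero_add, pow_one] at this
  exact this hf

/-- The tangent condition makes `y` transversal to `x`. As `β` is the smaller weight, all of `𝔪` has
weight at least `β`, so `w` and `x` are interchangeable. -/
lemma IsAdapted.isRSP_and_weightIdeal_eq (hdim : 2 ≤ ringKrullDim O) (hf0 : f ≠ 0)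
    (hn : 1 ≤ order f) (h : IsAdapted k f x z) (hyw : IsRSP y w) {β : ℝ}
    (hβ : β < (order f : ℝ)⁻¹) (hfy : f ∈ weightIdeal y w (order f : ℝ)⁻¹ β 1) :
    IsRSP x y ∧
      weightIdeal y w (order f : ℝ)⁻¹ β = weightIdeal y x (order f : ℝ)⁻¹ β := by
  obtain ⟨r, hr⟩ := exists_sub_mul_pow_mem (n := order f) hfy fun i j hi hij =>
    hyw.monomial_mem_pow (lt_add_of_one_le hn hβ hi hij)
  have hru := isUnit_of_sub_mul_pow_mem (mem_pow_order hf0).2 hyw.left_mem hr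
  obtain ⟨u, -, hu⟩ := h.tangent ⟨y, r, ⟨w, hyw.symm⟩, hru, hr⟩
  have hxy : IsRSP x y := h.isRSP.of_sub_mem_pow hdim hyw hru hn (s := u)
    (by simpa using Ideal.sub_mem _ hu hr)
  refine ⟨hxy, funext fun t => le_antisymm ?_ ?_⟩
  · exact weightIdeal_le_weightIdeal (left_mem_weightIdeal le_rfl)
      (hxy.symm.maximalIdeal_le_weightIdeal hβ.le le_rfl hyw.right_mem)
  · exact weightIdeal_le_weightIdeal (left_mem_weightIdeal le_rfl)
      (hyw.maximalIdeal_le_weightIdeal hβ.le le_rfl hxy.left_mem)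

/-- The characteristic polyhedron is a ray `[δ, ∞)` with `δ ≥ 1`, and `f` has weight at least one
for the corresponding weights. -/
lemma IsAdapted.exists_vertex (hdim : 2 ≤ ringKrullDim O)
    (hk : Function.Surjective (algebraMap k (ResidueField O))) (hf0 : f ≠ 0)
    (hn : 1 ≤ order f)
    (hpow : ∀ (y : O) (n : ℕ), IsParameter y → ¬ Associated f (y ^ n))
    (h : IsAdapted k f x z) :
    ∃ δ : ℚ, 1 ≤ δ ∧ characteristicPolyhedron k f x = Set.Ici (δ : ℝ) ∧
      f ∈ weightIdeal z x (order f : ℝ)⁻¹ ((order f : ℝ) * δ)⁻¹ 1 := by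
  have hn0 : (order f : ℝ) ≠ 0 := by
    rw [Nat.cast_ne_zero]; omega
  obtain ⟨hf1, hf2⟩ := mem_pow_order hf0
  -- The cofactor would be a unit because of the order of `f`.
  have hdvd : ¬ z ^ order f ∣ f := by
    rintro ⟨u, hu⟩
    have huu : IsUnit u := isUnit_of_sub_mul_pow_mem hf2 h.isRSP.right_mem (r := u)
      (by rw [mul_comm, ← hu, sub_self]; exact zero_mem _)
    obtain ⟨v, rfl⟩ := huu
    exact hpow z (order f) ⟨x, h.isRSP⟩ (Associated.symm ⟨v, hu.symm⟩)
  obtain ⟨δ, hδ⟩ := exists_projectedPolyhedron_eq_Ici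
    (exists_lt_of_not_dvd (k := k) hdim hk h.isRSP hdvd)
  have hδ1 : (1 : ℝ) ≤ δ := by
    have h1 : projectedPolyhedron k f x z ⊆ Set.Ici 1 := by
      rw [projectedPolyhedron_subset_Ici hdim hk h.isRSP hn one_pos, mul_one]
      exact h.isRSP.symm.pow_le_weightIdeal le_rfl le_rfl (mul_inv_cancel₀ hn0).ge hf1
    rw [hδ] at h1
    exact h1 Set.self_mem_Ici
  refine ⟨δ, by exact_mod_cast hδ1, h.polyhedron ▸ hδ, ?_⟩
  rw [← projectedPolyhedron_subset_Ici hdim hk h.isRSP hn (by linarith), hδ]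

lemma IsAdapted.le_of_admissible (hdim : 2 ≤ ringKrullDim O)
    (hk : Function.Surjective (algebraMap k (ResidueField O))) (hf0 : f ≠ 0)
    (hn : 1 ≤ order f) (h : IsAdapted k f x z) {δ : ℚ} (hδ1 : 1 ≤ δ)
    (hδ : characteristicPolyhedron k f x = Set.Ici (δ : ℝ)) {J : Center O}
    (hJ : J.Admissible k f) :
    J.a₁ ≤ order f ∧ (J.a₁ = order f → J.a₂ ≤ order f * δ) := by
  have hn0 : (0 : ℝ) < order f := by exact_mod_cast hn
  rw [J.admissible_iff hdim hk, Center.ideal] at hJ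
  obtain ⟨hp1, hp2⟩ := J.inv_pos
  have h1 : (0 : ℝ) < J.a₁ := inv_pos.1 hp1
  have h2 : (0 : ℝ) < J.a₂ := inv_pos.1 hp2
  have h12 : (J.a₁ : ℝ) ≤ J.a₂ := by exact_mod_cast J.a₁_le_a₂
  constructor
  · by_contra! hlt
    have hlt' : (order f : ℝ) < J.a₁ := by exact_mod_cast hlt
    refine (mem_pow_order hf0).2 (J.isRSP.weightIdeal_le_pow (fun i j hij => ?_) hJ)
    have h3 : (j : ℝ) * (J.a₂ : ℝ)⁻¹ ≤ j * (J.a₁ : ℝ)⁻¹ :=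
      mul_le_mul_of_nonneg_left (inv_anti₀ h1 h12) (by positivity)
    have h4 : 1 ≤ ((i + j : ℝ)) / J.a₁ := by
      rw [div_eq_mul_inv, add_mul]; linarith
    rw [one_le_div h1] at h4
    have h5 : (order f : ℝ) < i + j := by linarith
    exact_mod_cast h5
  · intro heq
    by_contra! hlt
    have hlt' : (order f : ℝ) * δ < J.a₂ := by exact_mod_cast hlt
    have heq' : (J.a₁ : ℝ) = order f := by exact_mod_cast heq
    have hδ1' : (1 : ℝ) ≤ δ := by exact_mod_cast hδ1
    rw [heq'] at hJ
    obtain ⟨hxy, hW⟩ := h.isRSP_and_weightIdeal_eq hdim hf0 hn J.isRSP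
      (inv_strictAnti₀ hn0 (by nlinarith)) hJ
    -- The weight `1 / a₂` corresponds to the vertex `a₂ / ν`, and `δ` lies in every projected
    -- polyhedron for `x`.
    rw [hW, show (J.a₂ : ℝ) = order f * (J.a₂ / order f) by field_simp,
      ← projectedPolyhedron_subset_Ici hdim hk hxy hn (by positivity)] at hJ
    have hmem : (δ : ℝ) ∈ characteristicPolyhedron k f x := hδ ▸ Set.self_mem_Ici
    have h6 := hJ (Set.mem_iInter₂.1 hmem _ hxy)
    rw [Set.mem_Ici, div_le_iff₀ hn0] at h6
    linarith

lemma IsAdapted.ideal_eq_of_admissible (hdim : 2 ≤ ringKrullDim O)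
    (hk : Function.Surjective (algebraMap k (ResidueField O))) (hf0 : f ≠ 0)
    (hn : 1 ≤ order f) (h : IsAdapted k f x z) {δ : ℚ} (hδ1 : 1 ≤ δ)
    (hfz : f ∈ weightIdeal z x (order f : ℝ)⁻¹ ((order f : ℝ) * δ)⁻¹ 1) {J : Center O}
    (hJ : J.Admissible k f) (h1 : J.a₁ = order f) (h2 : J.a₂ = order f * δ) :
    J.ideal = weightIdeal z x (order f : ℝ)⁻¹ ((order f : ℝ) * δ)⁻¹ := by
  have hn0 : (0 : ℝ) < order f := by exact_mod_cast hn
  have hz := h.isRSP.symm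
  rw [J.admissible_iff hdim hk] at hJ
  have hideal : J.ideal =
      weightIdeal J.x₁ J.x₂ (order f : ℝ)⁻¹ ((order f : ℝ) * δ)⁻¹ := by
    funext t
    rw [Center.ideal, h1, h2]
    push_cast
    rfl
  rw [hideal] at hJ ⊢
  -- For `δ = 1` the weights are equal and there need be no common tangent; any two systems of
  -- parameters then give the same filtration.
  rcases hδ1.eq_or_lt with rfl | hlt
  · simp only [Rat.cast_one, mul_one]
    refine funext fun t => le_antisymm ?_ ?_
    · exact weightIdeal_le_weightIdeal
        (hz.maximalIdeal_le_weightIdeal le_rfl le_rfl J.isRSP.left_mem)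
        (hz.maximalIdeal_le_weightIdeal le_rfl le_rfl J.isRSP.right_mem)
    · exact weightIdeal_le_weightIdeal
        (J.isRSP.maximalIdeal_le_weightIdeal le_rfl le_rfl hz.left_mem)
        (J.isRSP.maximalIdeal_le_weightIdeal le_rfl le_rfl hz.right_mem)
  · have hlt' : (1 : ℝ) < δ := by exact_mod_cast hlt
    have hβ : ((order f : ℝ) * δ)⁻¹ < (order f : ℝ)⁻¹ := inv_strictAnti₀ hn0 (by nlinarith)
    have hβ0 : 0 < ((order f : ℝ) * δ)⁻¹ := by positivity
    obtain ⟨hxy, hW⟩ := h.isRSP_and_weightIdeal_eq hdim hf0 hn J.isRSP hβ hJ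
    rw [hW] at hJ ⊢
    have hf2 := (mem_pow_order hf0).2
    refine funext fun t => le_antisymm ?_ ?_
    · exact weightIdeal_le_weightIdeal
        (h.isRSP.mem_weightIdeal_of_mem hdim hxy hn hf2 hβ0 hβ hfz hJ)
        (right_mem_weightIdeal le_rfl)
    · exact weightIdeal_le_weightIdeal
        (hxy.mem_weightIdeal_of_mem hdim h.isRSP hn hf2 hβ0 hβ hJ hfz)
        (right_mem_weightIdeal le_rfl)

/-- The center attached to adapted parameters and the vertex of the characteristic polyhedron. -/
noncomputable def IsAdapted.center (h : IsAdapted k f x z) (hn : 1 ≤ order f) {δ : ℚ} (hδ1 : 1 ≤ δ) :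
    Center O where
  x₁ := z
  x₂ := x
  a₁ := order f
  a₂ := order f * δ
  isRSP := h.isRSP.symm
  a₁_pos := by exact_mod_cast hn
  a₁_le_a₂ := le_mul_of_one_le_right (by positivity) hδ1

lemma Center.admissible_of_eq (hdim : 2 ≤ ringKrullDim O)
    (hk : Function.Surjective (algebraMap k (ResidueField O))) {J : Center O} {δ : ℚ}
    (hfz : f ∈ weightIdeal z x (order f : ℝ)⁻¹ ((order f : ℝ) * δ)⁻¹ 1)
    (h₁ : J.x₁ = z) (h₂ : J.x₂ = x) (ha₁ : J.a₁ = order f) (ha₂ : J.a₂ = order f * δ) :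
    J.Admissible k f := by
  rw [J.admissible_iff hdim hk, Center.ideal, h₁, h₂, ha₁, ha₂]
  push_cast
  exact hfz

end Adapted

end PlaneCurve

/-! ### The theorem -/

theorem theorem4p1 {k O : Type*} [Field k] [PerfectField k] [CommRing O] [IsRegularLocalRing O]
    [Algebra k O] (hdim : ringKrullDim O = 2)
    (hk : Function.Bijective (algebraMap k (IsLocalRing.ResidueField O)))
    (f : O) (hf0 : f ≠ 0) (hf : f ∈ IsLocalRing.maximalIdeal O ^ 2)
    (hpow : ∀ (y : O) (n : ℕ), PlaneCurve.IsParameter y → ¬ Associated f (y ^ n))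
    (x z : O) (hxz : PlaneCurve.IsAdapted k f x z) :
    ∃ δ : ℚ, PlaneCurve.characteristicPolyhedron k f x = Set.Ici (δ : ℝ) ∧
      ∃ J : PlaneCurve.Center O,
        (J.x₁ = z ∧ J.x₂ = x ∧
          J.a₁ = (PlaneCurve.order f : ℚ) ∧ J.a₂ = (PlaneCurve.order f : ℚ) * δ) ∧
        -- the center is admissible
        J.Admissible k f ∧
        -- its invariant is the lexicographic maximum over all admissible centers
        (∀ J' : PlaneCurve.Center O, J'.Admissible k f →
          toLex (J'.a₁, J'.a₂) ≤ toLex (J.a₁, J.a₂)) ∧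
        -- it is the only admissible center with this invariant
        (∀ J' : PlaneCurve.Center O, J'.Admissible k f →
          J'.a₁ = J.a₁ → J'.a₂ = J.a₂ → J'.val k = J.val k) ∧
        -- every other choice of parameters gives the same exponents and the same valuation
        (∀ x' z' : O, PlaneCurve.IsAdapted k f x' z' →
          PlaneCurve.characteristicPolyhedron k f x' = Set.Ici (δ : ℝ) ∧
          ∀ J' : PlaneCurve.Center O, J'.x₁ = z' → J'.x₂ = x' →
            J'.a₁ = J.a₁ → J'.a₂ = J.a₂ → J'.val k = J.val k) := by
  have hdim' : 2 ≤ ringKrullDim O := hdim.ge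
  have hk' := hk.surjective
  have hn : 1 ≤ PlaneCurve.order f := PlaneCurve.order_pos hf0 (Ideal.pow_le_self two_ne_zero hf)
  have hn0 : (0 : ℚ) < PlaneCurve.order f := by exact_mod_cast hn
  obtain ⟨δ, hδ1, hδ, hfz⟩ := hxz.exists_vertex hdim' hk' hf0 hn hpow
  have hJ : (hxz.center hn hδ1).Admissible k f :=
    PlaneCurve.Center.admissible_of_eq hdim' hk' hfz rfl rfl rfl rfl
  have hunique : ∀ J' : PlaneCurve.Center O, J'.Admissible k f →
      J'.a₁ = PlaneCurve.order f → J'.a₂ = PlaneCurve.order f * δ →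
      J'.val k = (hxz.center hn hδ1).val k := fun J' hJ' h1 h2 =>
    PlaneCurve.Center.val_eq_of_ideal_eq hdim' hk'
      ((hxz.ideal_eq_of_admissible hdim' hk' hf0 hn hδ1 hfz hJ' h1 h2).trans
        (hxz.ideal_eq_of_admissible hdim' hk' hf0 hn hδ1 hfz hJ rfl rfl).symm)
  refine ⟨δ, hδ, hxz.center hn hδ1, ⟨rfl, rfl, rfl, rfl⟩, hJ, fun J' hJ' => ?_, hunique,
    fun x' z' h' => ?_⟩
  · obtain ⟨h1, h2⟩ := hxz.le_of_admissible hdim' hk' hf0 hn hδ1 hδ hJ'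
    rw [Prod.Lex.toLex_le_toLex]
    exact h1.lt_or_eq.imp_right fun h => ⟨h, h2 h⟩
  · obtain ⟨δ', hδ1', hδ', hfz'⟩ := h'.exists_vertex hdim' hk' hf0 hn hpow
    have hJ' : (h'.center hn hδ1').Admissible k f :=
      PlaneCurve.Center.admissible_of_eq hdim' hk' hfz' rfl rfl rfl rfl
    -- Each center is admissible and hence bounded by the other, which forces `δ' = δ`.
    have h1 := (hxz.le_of_admissible hdim' hk' hf0 hn hδ1 hδ hJ').2 rfl
    have h2 := (h'.le_of_admissible hdim' hk' hf0 hn hδ1' hδ' hJ).2 rfl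
    obtain rfl : δ' = δ :=
      le_antisymm (le_of_mul_le_mul_left h1 hn0) (le_of_mul_le_mul_left h2 hn0)
    exact ⟨hδ', fun J' hx₁ hx₂ ha₁ ha₂ => hunique J'
      (PlaneCurve.Center.admissible_of_eq hdim' hk' hfz' hx₁ hx₂ ha₁ ha₂) ha₁ ha₂⟩
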